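/- Consider the following adversarial queueing model $\mathcal{DF}_\delta$, where $\delta \ge 1$ is an integer. A network is a finite directed graph, with a queue at the tail of every link. Time proceeds in rounds. In each round an adversary injects finitely many packets, assigning to each one a (nonempty) directed path that contains no link more than once. Then, on every link $q$ whose queue is nonempty, the scheduling policy chooses one packet of the queue and attempts to transmit it over $q$. The attempt may fail, in which case the queue $q$ is said to be stalled in this round and the packet stays in the queue; otherwise the packet crosses $q$ and joins the queue of the next link of its path, or disappears if $q$ was the last one. If $q$ is stalled in round $t$, then the adversary is notified of this in some round $t'$ with $t \le t' \le t+\delta$. Let $w_q^\delta(t)$ be the number of notifications for $q$ that arrive in round $t$. The reactive function $s_q^\delta$ is obtained as follows: for $t = 1, 2, \dots$ in turn, the $w_q^\delta(t)$ notifications arriving in round $t$ reserve the $w_q^\delta(t)$ consecutive rounds starting with the first round that is at least $t$ and is later than all rounds reserved so far; put $s_q^\delta(t)=1$ if round $t$ is reserved and $s_q^\delta(t)=0$ otherwise. The adversary has injection rate $r$ and burstiness $b$ (an integer, $b \ge 1$) if for every link $q$ and every contiguous interval $T$ of rounds $$\sum_{t\in T} I_q^\delta(t) \;\le\; r\sum_{t\in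 T}\bigl(1-s_q^\delta(t)\bigr)+b ,$$ where $I_q^\delta(t)$ is the number of packets injected in round $t$ whose paths contain $q$. A scheduling policy is universally stable in $\mathcal{DF}_\delta$ if for every network, every $0 \le r < 1$ and every $b \ge 1$, in each execution of the policy against an adversary with injection rate $r$ and burstiness $b$, the number of packets in the system is bounded over all rounds. Then, for every integer $\delta\ge 1$, each of the following scheduling policies, with ties broken arbitrarily, is universally stable in $\mathcal{DF}_\delta$: Farthest-To-Go (choose a packet with the largest number of links still to cross), Nearest-From-Source (choose a packet with the smallest number of links already crossed), and Shortest-In-System (choose a packet injected most recently). -/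

import Mathlib

universe u v

noncomputable section

/-- A network: a directed graph with node type `V` and link type `E`; the link `e` transmits from
`src e` to `tgt e`. Every link has its own queue, located at its tail. -/
structure Network (V E : Type*) where
  src : E → V
  tgt : E → V

/-- The data of a run of a routing protocol. Rounds are numbered `0, 1, 2, …`.
* `num t` is the number of packets that the adversary injects in round `t`, and `path t k` is the
  list of links assigned to the `k`-th of them.
* `attempt t e` is the packet which is scheduled for transmission over the link `e` in round `t`
  (`none` if there is no such packet).
* `stalled t e` says that the transmission attempted over `e` in round `t` fails.
* `notify e t` is the round in which the feedback about `e` being stalled in round `t` arrives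
  (relevant only if `e` is stalled in round `t`). -/
structure Run (E : Type*) where
  num : ℕ → ℕ
  path : (t : ℕ) → Fin (num t) → List E
  attempt : ℕ → E → Option ((t : ℕ) × Fin (num t))
  stalled : ℕ → E → Prop
  notify : E → ℕ → ℕ

namespace Run

variable {E : Type*} (R : Run E)

/-- The packets of a run: a packet is named by its injection round and its number there. -/
abbrev Packet : Type := (t : ℕ) × Fin (R.num t)

/-- The path assigned to a packet. -/
def route (p : R.Packet) : List E := R.path p.1 p.2

open Classical in
/-- The number of links that a packet has crossed before round `t`: it crosses a link in each round
in which its transmission is attempted and does not fail. -/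
def crossed : ℕ → R.Packet → ℕ
  | 0, _ => 0
  | t + 1, p =>
      if ∃ e, R.attempt t e = some p ∧ ¬ R.stalled t e then crossed t p + 1 else crossed t p

/-- The packets waiting in the queue of the link `e` in round `t`, after the injections of the
round and before its transmissions: those that have been injected and have `e` as the next link. -/
def queue (t : ℕ) (e : E) : Set R.Packet :=
  {p | p.1 ≤ t ∧ (R.route p)[R.crossed t p]? = some e}

/-- The packets in the system in round `t`: injected, and not yet at the end of their paths. -/
def inSystem (t : ℕ) : Finset R.Packet :=
  ((Finset.range (t + 1)).sigma fun _ => Finset.univ).filter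
    fun p => R.crossed t p < (R.route p).length

/-- The number of packets injected in round `t` that have the link `e` on their paths. -/
def injections (e : E) (t : ℕ) : ℕ :=
  Nat.card {k : Fin (R.num t) // e ∈ R.path t k}

open Classical in
/-- The number of notifications of stalling of `e` that arrive in round `t`. -/
def notifications (e : E) (t : ℕ) : ℕ :=
  ((Finset.range (t + 1)).filter fun u => R.stalled u e ∧ R.notify e u = t).card

end Run

/-- The first round that is still available for a reaction when round `t` begins, if `w u`
notifications arrive in round `u`, for each `u`. The notifications arriving in round `u` reserve
the `w u` consecutive rounds that start with the first available one which is at least `u`. -/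
def nextAvailable (w : ℕ → ℕ) : ℕ → ℕ
  | 0 => 0
  | t + 1 => if w t = 0 then nextAvailable w t else max t (nextAvailable w t) + w t

open Classical in
/-- The reactive function: it is `1` in the rounds reserved by some notifications, and `0` in all
other rounds. -/
def reactive (w : ℕ → ℕ) (t : ℕ) : ℕ :=
  if ∃ u, max u (nextAvailable w u) ≤ t ∧ t < max u (nextAvailable w u) + w u then 1 else 0

/-- What a scheduling policy looks at in a packet: its injection round, the number of links that it
has crossed already, and the number of links that it still has to cross. -/
structure PacketView where
  injectedAt : ℕ
  traveled : ℕ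
  remaining : ℕ

/-- The view of a packet in round `t`. -/
def Run.view {E : Type*} (R : Run E) (t : ℕ) (p : R.Packet) : PacketView where
  injectedAt := p.1
  traveled := R.crossed t p
  remaining := (R.route p).length - R.crossed t p

/-- A scheduling policy is given by a rank: in each queue, a packet of the greatest rank is
scheduled, with ties broken in an arbitrary way. -/
structure SchedulingPolicy where
  rank : PacketView → ℤ

namespace SchedulingPolicy

/-- Farthest-To-Go. -/
def FTG : SchedulingPolicy := ⟨fun v => v.remaining⟩

/-- Nearest-From-Source. -/
def NFS : SchedulingPolicy := ⟨fun v => -(v.traveled : ℤ)⟩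

/-- Shortest-In-System. -/
def SIS : SchedulingPolicy := ⟨fun v => v.injectedAt⟩

end SchedulingPolicy

/-- `R` is an execution of the policy `P` in the network `G` against an adversary with injection
rate `r` and burstiness `b`, with feedback delayed by up to `δ` rounds. -/
structure IsExecution {V E : Type*} (G : Network V E) (P : SchedulingPolicy)
    (r : ℝ) (b δ : ℕ) (R : Run E) : Prop where
  /-- Every packet is assigned a nonempty path that contains no link more than once. -/
  route_ne_nil : ∀ p, R.route p ≠ []
  route_chain : ∀ p, (R.route p).IsChain fun e f => G.tgt e = G.src f
  route_nodup : ∀ p, (R.route p).Nodup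
  /-- A scheduled packet waits in the queue; a nonempty queue has a scheduled packet. -/
  attempt_mem : ∀ t e p, R.attempt t e = some p → p ∈ R.queue t e
  attempt_exists : ∀ t e, (R.queue t e).Nonempty → ∃ p, R.attempt t e = some p
  /-- The scheduled packet has the greatest rank in the queue. -/
  attempt_rank : ∀ t e p, R.attempt t e = some p →
    ∀ p' ∈ R.queue t e, P.rank (R.view t p') ≤ P.rank (R.view t p)
  /-- A queue is stalled only if a transmission is attempted. -/
  stalled_attempt : ∀ t e, R.stalled t e → ∃ p, R.attempt t e = some p
  /-- The feedback about a stalled queue arrives after at most `δ` rounds. -/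
  notify_mem : ∀ t e, R.stalled t e → t ≤ R.notify e t ∧ R.notify e t ≤ t + δ
  /-- The admissibility condition, for every link and every contiguous time interval. -/
  admissible : ∀ (e : E) (t₁ t₂ : ℕ),
    ∑ t ∈ Finset.Icc t₁ t₂, (R.injections e t : ℝ) ≤
      r * ∑ t ∈ Finset.Icc t₁ t₂, (1 - (reactive (R.notifications e) t : ℝ)) + b

/-- `P` is stable in `G` against the adversary: in each execution, the numbers of packets in the
system are bounded. -/
def IsStable {V E : Type*} (G : Network V E) (P : SchedulingPolicy) (r : ℝ) (b δ : ℕ) : Prop :=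
  ∀ R : Run E, IsExecution G P r b δ R → ∃ B : ℕ, ∀ t, (R.inSystem t).card ≤ B

/-- `P` is universally stable in the model with feedback delayed by up to `δ` rounds: it is stable
in every finite network, against every adversary with an injection rate less than `1`. -/
def IsUniversallyStable (δ : ℕ) (P : SchedulingPolicy) : Prop :=
  ∀ (V : Type u) (E : Type v) [Finite V] [Finite E] (G : Network V E) (r : ℝ) (b : ℕ),
    0 ≤ r → r < 1 → 1 ≤ b → IsStable G P r b δ

end

/-! Measure time at each link by its open (non-stalled) rounds. Reserved rounds keep pace with
notifications and notifications with stalls, each up to an error of `δ`. Hence at most `r` times the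
number of open rounds of an interval plus `b + 2δ` packets needing a link are injected in that
interval (`sum_injections_le`). While a queue is nonempty, each open round carries a distinct packet
across the link (`card_add_openRounds_le`).

For Nearest-From-Source and Farthest-To-Go, classify packets by links crossed or still to cross. A
preferred class is never delayed by packets outside it, and is fed only by new injections and the
next smaller class. Its size is therefore bounded by induction; `r ≤ 1` suffices.

Under Shortest-In-System the preferred packets are the newer ones, and that induction fails. Let `x
i` be one plus the maximum, over rounds up to `t`, of the number of packets that have crossed fewer
than `i` links, and let `X = x n` count all packets, `n` being the number of links. A packet in a
queue has few newer companions unless it travelled there through many open rounds of that link.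
Double counting pairs of such a round and a packet under way gives `x (i + 1) ^ 2 ≤ C * x i * X`.
Since `x 0 = 1`, this forces `X ≤ C ^ 2 ^ n`, uniformly in `t`. -/

/-! ### Reserved rounds versus notifications -/

/-- The first round at or after `t` that is not reserved when round `t` begins. -/
def firstFree (w : ℕ → ℕ) (t : ℕ) : ℕ := max t (nextAvailable w t)

theorem firstFree_succ (w : ℕ → ℕ) (t : ℕ) :
    firstFree w (t + 1) = max (t + 1) (firstFree w t + w t) := by
  unfold firstFree
  rw [nextAvailable]
  split_ifs with h <;> omega

/-- Unrolling the recursion back to the last round `u` that began with no backlog: from there on,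
reservations are contiguous. -/
theorem exists_firstFree_eq (w : ℕ → ℕ) (t : ℕ) :
    ∃ u ≤ t, firstFree w t = u + ∑ v ∈ Finset.Ico u t, w v := by
  induction t with
  | zero => exact ⟨0, le_rfl, by simp [firstFree, nextAvailable]⟩
  | succ t ih =>
    obtain ⟨u, hu, h⟩ := ih
    rw [firstFree_succ]
    rcases le_total (firstFree w t + w t) (t + 1) with h1 | h1
    · exact ⟨t + 1, le_rfl, by simp [max_eq_left h1]⟩
    · refine ⟨u, by omega, ?_⟩
      rw [max_eq_right h1, Finset.sum_Ico_succ_top hu, h, add_assoc]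

theorem firstFree_le {w : ℕ → ℕ} {δ : ℕ}
    (hw : ∀ u t, u ≤ t → ∑ v ∈ Finset.Ico u t, w v ≤ t - u + δ) (t : ℕ) :
    firstFree w t ≤ t + δ := by
  obtain ⟨u, hu, h⟩ := exists_firstFree_eq w t
  have := hw u t hu
  omega

theorem reactive_eq_one {w : ℕ → ℕ} {n x : ℕ} (h₁ : firstFree w n ≤ x)
    (h₂ : x < firstFree w n + w n) : reactive w x = 1 := if_pos ⟨n, h₁, h₂⟩

theorem reactive_le_one (w : ℕ → ℕ) (x : ℕ) : reactive w x ≤ 1 := by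
  unfold reactive
  split_ifs <;> omega

theorem sum_le_sum_reactive_firstFree (w : ℕ → ℕ) {a n : ℕ} (h : a ≤ n) :
    ∑ v ∈ Finset.Ico a n, w v ≤ ∑ x ∈ Finset.Ico a (firstFree w n), reactive w x := by
  induction n, h using Nat.le_induction with
  | base => simp
  | succ n hn ih =>
    have h1 : a ≤ firstFree w n := hn.trans (le_max_left _ _)
    have h2 : firstFree w n + w n ≤ firstFree w (n + 1) := by
      rw [firstFree_succ]
      exact le_max_right _ _
    have h3 : ∑ x ∈ Finset.Ico (firstFree w n) (firstFree w n + w n), reactive w x = w n := by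
      rw [Finset.sum_congr rfl fun x hx => reactive_eq_one (Finset.mem_Ico.1 hx).1
        (Finset.mem_Ico.1 hx).2]
      simp
    calc ∑ v ∈ Finset.Ico a (n + 1), w v = ∑ v ∈ Finset.Ico a n, w v + w n :=
          Finset.sum_Ico_succ_top hn _
      _ ≤ ∑ x ∈ Finset.Ico a (firstFree w n), reactive w x
          + ∑ x ∈ Finset.Ico (firstFree w n) (firstFree w n + w n), reactive w x := by
          rw [h3]
          omega
      _ = ∑ x ∈ Finset.Ico a (firstFree w n + w n), reactive w x :=
          Finset.sum_Ico_consecutive _ h1 (by omega)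
      _ ≤ _ := Finset.sum_le_sum_of_subset (Finset.Ico_subset_Ico_right h2)

/-- The notifications of an interval are served within the interval, up to `δ` of them. -/
theorem sum_le_sum_reactive_add {w : ℕ → ℕ} {δ : ℕ}
    (hw : ∀ u t, u ≤ t → ∑ v ∈ Finset.Ico u t, w v ≤ t - u + δ) {a n : ℕ} (h : a ≤ n) :
    ∑ v ∈ Finset.Ico a n, w v ≤ ∑ x ∈ Finset.Ico a n, reactive w x + δ := by
  have h1 : n ≤ firstFree w n := le_max_left _ _
  have h2 := firstFree_le hw n
  have h3 : ∑ x ∈ Finset.Ico n (firstFree w n), reactive w x ≤ δ :=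
    (Finset.sum_le_card_nsmul _ _ 1 fun x _ => reactive_le_one w x).trans (by simp; omega)
  have h4 := sum_le_sum_reactive_firstFree w h
  rw [← Finset.sum_Ico_consecutive _ h h1] at h4
  omega

/-! ### Open rounds versus notifications -/

namespace Run

variable {E : Type*} (R : Run E)

open Classical in
/-- The number of rounds in `[x, y)` in which the link `e` is not stalled. -/
noncomputable def openRounds (e : E) (x y : ℕ) : ℕ :=
  ((Finset.Ico x y).filter fun u => ¬ R.stalled u e).card

theorem openRounds_le_add (e : E) (x y z : ℕ) :
    R.openRounds e x z ≤ R.openRounds e x y + R.openRounds e y z := by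
  classical
  unfold openRounds
  refine le_trans (Finset.card_le_card ?_) (Finset.card_union_le _ _)
  intro u
  simp only [Finset.mem_filter, Finset.mem_union, Finset.mem_Ico]
  intro h
  rcases lt_or_ge u y with hu | hu
  · exact Or.inl ⟨⟨h.1.1, hu⟩, h.2⟩
  · exact Or.inr ⟨⟨hu, h.1.2⟩, h.2⟩

theorem openRounds_succ_le (e : E) (x y : ℕ) :
    R.openRounds e x (y + 1) ≤ R.openRounds e x y + 1 := by
  classical
  refine (R.openRounds_le_add e x y (y + 1)).trans (Nat.add_le_add_left ?_ _)
  exact (Finset.card_filter_le _ _).trans (by simp)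

theorem openRounds_self (e : E) (x : ℕ) : R.openRounds e x x = 0 := by
  simp [openRounds]

open Classical in
theorem sum_notifications (e : E) (hle : ∀ v, R.stalled v e → v ≤ R.notify e v) (x y : ℕ) :
    ∑ t ∈ Finset.Ico x y, R.notifications e t =
      ((Finset.range y).filter fun v => R.stalled v e ∧
        x ≤ R.notify e v ∧ R.notify e v < y).card := by
  rw [Finset.card_eq_sum_card_fiberwise (f := R.notify e) (t := Finset.Ico x y)]
  · refine Finset.sum_congr rfl fun t ht => ?_
    unfold notifications
    congr 1
    ext v
    simp only [Finset.mem_filter, Finset.mem_range, Finset.mem_Ico] at ht ⊢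
    constructor
    · rintro ⟨h1, h2, h3⟩
      exact ⟨⟨by omega, h2, by omega, by omega⟩, h3⟩
    · rintro ⟨⟨h1, h2, h3, h4⟩, h5⟩
      have := hle v h2
      exact ⟨by omega, h2, h5⟩
  · intro v hv
    simp only [Finset.coe_filter, Set.mem_ofPred_eq, Finset.coe_Ico, Set.mem_Ico] at hv ⊢
    exact hv.2.2

variable {R} {δ : ℕ} {e : E}

theorem sum_notifications_le (hn : ∀ v, R.stalled v e → v ≤ R.notify e v ∧ R.notify e v ≤ v + δ)
    (x y : ℕ) (hxy : x ≤ y) :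
    ∑ t ∈ Finset.Ico x y, R.notifications e t ≤ y - x + δ := by
  classical
  rw [R.sum_notifications e fun v hv => (hn v hv).1]
  have : ((Finset.range y).filter fun v => R.stalled v e ∧
        x ≤ R.notify e v ∧ R.notify e v < y) ⊆ Finset.Ico (x - δ) y := by
    intro v
    simp only [Finset.mem_filter, Finset.mem_range, Finset.mem_Ico]
    rintro ⟨h1, h2, h3, h4⟩
    have := hn v h2
    omega
  refine (Finset.card_le_card this).trans ?_
  simp only [Nat.card_Ico]
  omega

theorem le_sum_notifications_add
    (hn : ∀ v, R.stalled v e → v ≤ R.notify e v ∧ R.notify e v ≤ v + δ) (x y : ℕ) :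
    y - x ≤ R.openRounds e x y + (∑ t ∈ Finset.Ico x y, R.notifications e t + δ) := by
  classical
  rw [R.sum_notifications e fun v hv => (hn v hv).1]
  -- A stalled round whose notification does not arrive before `y` is one of the last `δ` rounds.
  have : Finset.Ico x y ⊆ ((Finset.Ico x y).filter fun u => ¬ R.stalled u e) ∪
      (((Finset.range y).filter fun v => R.stalled v e ∧
        x ≤ R.notify e v ∧ R.notify e v < y) ∪ Finset.Ico (y - δ) y) := by
    intro v
    simp only [Finset.mem_filter, Finset.mem_range, Finset.mem_Ico, Finset.mem_union]
    intro hv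
    by_cases hs : R.stalled v e
    · have := hn v hs
      simp only [hs, not_true, and_false, false_or, true_and]
      omega
    · exact Or.inl ⟨hv, hs⟩
  have h2 := (Finset.card_le_card this).trans ((Finset.card_union_le _ _).trans
    (Nat.add_le_add_left (Finset.card_union_le _ _) _))
  simp only [Nat.card_Ico] at h2
  unfold openRounds
  omega

end Run

/-! ### Injections measured in open rounds -/

namespace IsExecution

variable {V E : Type*} {G : Network V E} {P : SchedulingPolicy} {r : ℝ} {b δ : ℕ} {R : Run E}

theorem sum_injections_le (h : IsExecution G P r b δ R) (hr : 0 ≤ r) (hr1 : r ≤ 1) (e : E)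
    {x y : ℕ} (hxy : x ≤ y) :
    ((∑ t ∈ Finset.Icc x y, R.injections e t : ℕ) : ℝ) ≤
      r * R.openRounds e x (y + 1) + (b + 2 * δ : ℕ) := by
  have hn := fun v => h.notify_mem v e
  have h1 := Run.le_sum_notifications_add hn x (y + 1)
  have h2 := sum_le_sum_reactive_add (Run.sum_notifications_le hn) (a := x) (n := y + 1)
    (by omega)
  -- One `δ` pays for late notifications, the other for reservations beyond the interval.
  have h3 : y + 1 ≤ x + R.openRounds e x (y + 1) +
      ∑ t ∈ Finset.Ico x (y + 1), reactive (R.notifications e) t + 2 * δ := by omega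
  have h4 := h.admissible e x y
  have h5 : Finset.Icc x y = Finset.Ico x (y + 1) := by ext; simp
  rw [h5] at h4 ⊢
  have h6 : ((y : ℝ) + 1) ≤ x + R.openRounds e x (y + 1) +
      ∑ t ∈ Finset.Ico x (y + 1), (reactive (R.notifications e) t : ℝ) + 2 * δ := by
    exact_mod_cast h3
  rw [Finset.sum_sub_distrib] at h4
  have h7 : ∑ t ∈ Finset.Ico x (y + 1), (1 : ℝ) = y + 1 - x := by
    simp [Nat.cast_sub (by omega : x ≤ y + 1)]
  rw [h7] at h4
  have h8 := mul_le_mul_of_nonneg_left (show (y : ℝ) + 1 - x -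
    ∑ t ∈ Finset.Ico x (y + 1), (reactive (R.notifications e) t : ℝ) ≤
      R.openRounds e x (y + 1) + 2 * δ by linarith) hr
  have h9 : r * (2 * (δ : ℝ)) ≤ 2 * δ := mul_le_of_le_one_left (by positivity) hr1
  push_cast
  linarith

theorem sum_injections_le_nat (h : IsExecution G P r b δ R) (hr : 0 ≤ r) (hr1 : r ≤ 1) (e : E)
    {x y : ℕ} (hxy : x ≤ y) :
    ∑ t ∈ Finset.Icc x y, R.injections e t ≤ R.openRounds e x (y + 1) + (b + 2 * δ) := by
  have h1 := h.sum_injections_le hr hr1 e hxy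
  have h2 : r * (R.openRounds e x (y + 1) : ℝ) ≤ R.openRounds e x (y + 1) :=
    mul_le_of_le_one_left (by positivity) hr1
  exact_mod_cast h1.trans (add_le_add_left h2 _)

end IsExecution

/-! ### Queues, crossings and busy periods -/

namespace Run

variable {E : Type*} (R : Run E)

theorem crossed_le_succ (t : ℕ) (p : R.Packet) : R.crossed t p ≤ R.crossed (t + 1) p := by
  rw [crossed]
  split_ifs <;> omega

theorem crossed_mono (p : R.Packet) : Monotone fun t => R.crossed t p :=
  monotone_nat_of_le_succ fun t => R.crossed_le_succ t p

variable {R}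

theorem crossed_succ_of_attempt {t : ℕ} {e : E} {p : R.Packet} (h : R.attempt t e = some p)
    (hs : ¬ R.stalled t e) : R.crossed (t + 1) p = R.crossed t p + 1 := by
  rw [crossed, if_pos ⟨e, h, hs⟩]

theorem mem_inSystem {t : ℕ} {p : R.Packet} :
    p ∈ R.inSystem t ↔ p.1 ≤ t ∧ R.crossed t p < (R.route p).length := by
  simp [inSystem]

theorem mem_inSystem_of_mem_queue {t : ℕ} {e : E} {p : R.Packet} (h : p ∈ R.queue t e) :
    p ∈ R.inSystem t :=
  mem_inSystem.2 ⟨h.1, (List.getElem?_eq_some_iff.1 h.2).1⟩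

theorem mem_route_of_mem_queue {t : ℕ} {e : E} {p : R.Packet} (h : p ∈ R.queue t e) :
    e ∈ R.route p := List.mem_of_getElem? h.2

theorem exists_mem_queue {t : ℕ} {p : R.Packet} (h : p ∈ R.inSystem t) :
    ∃ e, p ∈ R.queue t e := by
  rw [mem_inSystem] at h
  exact ⟨_, h.1, List.getElem?_eq_getElem h.2⟩

variable (R) in
open Classical in
/-- The packets injected in the rounds `x, …, y` whose paths contain `e`. -/
noncomputable def injected (e : E) (x y : ℕ) : Finset R.Packet :=
  (Finset.Icc x y).sigma fun t => Finset.univ.filter fun k => e ∈ R.path t k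

theorem mem_injected {e : E} {x y : ℕ} {p : R.Packet} :
    p ∈ R.injected e x y ↔ (x ≤ p.1 ∧ p.1 ≤ y) ∧ e ∈ R.route p := by
  simp [injected, route]

theorem card_injected (e : E) (x y : ℕ) :
    (R.injected e x y).card = ∑ t ∈ Finset.Icc x y, R.injections e t := by
  classical
  rw [injected, Finset.card_sigma]
  refine Finset.sum_congr rfl fun t _ => ?_
  rw [injections, Nat.card_eq_fintype_card, Fintype.card_subtype]

end Run

namespace IsExecution

variable {V E : Type*} {G : Network V E} {P : SchedulingPolicy} {r : ℝ} {b δ : ℕ} {R : Run E}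

theorem crossed_eq_of_mem_queue (h : IsExecution G P r b δ R) {t u : ℕ} {e : E} {p : R.Packet}
    (ht : p ∈ R.queue t e) (hu : p ∈ R.queue u e) : R.crossed t p = R.crossed u p := by
  have h1 := List.getElem?_eq_some_iff.1 ht.2
  exact List.getElem?_inj h1.1 (h.route_nodup p) |>.1 (ht.2.trans hu.2.symm)

theorem mem_queue_of_mem_Icc (h : IsExecution G P r b δ R) {s t u : ℕ} {e : E} {p : R.Packet}
    (hs : p ∈ R.queue s e) (ht : p ∈ R.queue t e) (hsu : s ≤ u) (hut : u ≤ t) :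
    p ∈ R.queue u e := by
  have h1 := h.crossed_eq_of_mem_queue hs ht
  have h2 := R.crossed_mono p hsu
  have h3 := R.crossed_mono p hut
  simp only at h2 h3
  refine ⟨hs.1.trans hsu, ?_⟩
  rw [show R.crossed u p = R.crossed s p by omega]
  exact hs.2

/-- A packet that crosses a link does not wait at that link later. -/
theorem notMem_queue_of_attempt (h : IsExecution G P r b δ R) {t u : ℕ} {e : E} {p : R.Packet}
    (hp : R.attempt t e = some p) (hs : ¬ R.stalled t e) (htu : t < u) : p ∉ R.queue u e := by
  intro hu
  have h1 := h.crossed_eq_of_mem_queue (h.attempt_mem t e p hp) hu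
  have h2 := Run.crossed_succ_of_attempt hp hs
  have h3 := R.crossed_mono p (Nat.succ_le_of_lt htu)
  simp only [Nat.succ_eq_add_one] at h3
  omega

/-- While the queue of `e` is nonempty, a packet crosses `e` in every round without stalling. -/
theorem card_add_openRounds_le (h : IsExecution G P r b δ R) {e : E} {a c t : ℕ}
    (hq : ∀ u, a ≤ u → u < t → (R.queue u e).Nonempty) (S F : Finset R.Packet)
    (hS : ∀ p ∈ S, p ∈ R.queue t e ∧ (c ≤ p.1 ∨ p ∈ F))
    (hF : ∀ u p, a ≤ u → u < t → R.attempt u e = some p → c ≤ p.1 ∨ p ∈ F) :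
    S.card + R.openRounds e a t ≤ F.card + ∑ x ∈ Finset.Icc c t, R.injections e x := by
  classical
  set D := (Finset.Ico a t).filter fun u => ¬ R.stalled u e with hD
  have hatt : ∀ u ∈ D, ∃ p, R.attempt u e = some p := fun u hu => by
    simp only [hD, Finset.mem_filter, Finset.mem_Ico] at hu
    exact h.attempt_exists u e (hq u hu.1.1 hu.1.2)
  -- Paths repeat no link, so a packet crosses `e` at most once.
  have hinj : Set.InjOn (fun u => R.attempt u e) D := by
    have key : ∀ u ∈ D, ∀ v ∈ D, u < v → R.attempt u e ≠ R.attempt v e := by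
      intro u hu v hv huv heq
      obtain ⟨p, hp⟩ := hatt u hu
      simp only [hD, Finset.mem_filter] at hu
      exact h.notMem_queue_of_attempt hp hu.2 huv (h.attempt_mem v e p (heq ▸ hp))
    intro u hu v hv heq
    rcases lt_trichotomy u v with h1 | h1 | h1
    · exact absurd heq (key u hu v hv h1)
    · exact h1
    · exact absurd heq.symm (key v hv u hu h1)
  have hdisj : Disjoint (S.image some) (D.image fun u => R.attempt u e) := by
    rw [Finset.disjoint_left]
    intro o ho ho'
    obtain ⟨p, hp, rfl⟩ := Finset.mem_image.1 ho
    obtain ⟨u, hu, hup⟩ := Finset.mem_image.1 ho'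
    simp only [hD, Finset.mem_filter, Finset.mem_Ico] at hu
    exact h.notMem_queue_of_attempt hup hu.2 hu.1.2 (hS p hp).1
  have hsub : S.image some ∪ (D.image fun u => R.attempt u e) ⊆
      (F ∪ R.injected e c t).image some := by
    intro o ho
    rw [Finset.mem_union] at ho
    rcases ho with ho | ho
    · obtain ⟨p, hp, rfl⟩ := Finset.mem_image.1 ho
      obtain ⟨h1, h2⟩ := hS p hp
      refine Finset.mem_image_of_mem _ (Finset.mem_union.2 (h2.symm.imp_right fun h2 => ?_))
      exact Run.mem_injected.2 ⟨⟨h2, h1.1⟩, Run.mem_route_of_mem_queue h1⟩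
    · obtain ⟨u, hu, rfl⟩ := Finset.mem_image.1 ho
      obtain ⟨p, hp⟩ := hatt u hu
      simp only [hD, Finset.mem_filter, Finset.mem_Ico] at hu
      have h1 := h.attempt_mem u e p hp
      rw [hp]
      refine Finset.mem_image_of_mem _ (Finset.mem_union.2
        ((hF u p hu.1.1 hu.1.2 hp).symm.imp_right fun h2 => ?_))
      exact Run.mem_injected.2 ⟨⟨h2, h1.1.trans hu.1.2.le⟩, Run.mem_route_of_mem_queue h1⟩
  have h1 := Finset.card_le_card hsub
  rw [Finset.card_union_of_disjoint hdisj, Finset.card_image_of_injective _ (Option.some_injective _),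
    Finset.card_image_of_injOn hinj, Finset.card_image_of_injective _ (Option.some_injective _)] at h1
  have h2 := Finset.card_union_le F (R.injected e c t)
  rw [Run.card_injected] at h2
  exact h1.trans h2

open Classical in
theorem card_filter_inSystem_le_sum [Fintype E] (t : ℕ) (Q : R.Packet → Prop) :
    ((R.inSystem t).filter Q).card ≤
      ∑ e : E, ((R.inSystem t).filter fun p => p ∈ R.queue t e ∧ Q p).card := by
  refine (Finset.card_le_card ?_).trans Finset.card_biUnion_le
  intro p hp
  rw [Finset.mem_filter] at hp
  obtain ⟨e, he⟩ := Run.exists_mem_queue hp.1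
  exact Finset.mem_biUnion.2 ⟨e, Finset.mem_univ _, Finset.mem_filter.2 ⟨hp.1, he, hp.2⟩⟩

theorem length_route_le [Fintype E] (h : IsExecution G P r b δ R) (p : R.Packet) :
    (R.route p).length ≤ Fintype.card E := (h.route_nodup p).length_le_card

/-! ### Nearest-From-Source and Farthest-To-Go: preferred classes -/

open Classical in
/-- If `H j` are classes of packets that are preferred by the policy, and a packet of the class
`j + 1` was in the class `j` before its last crossing, then the numbers of packets of the classes
are bounded by induction on `j`. Membership in a class depends on the number of crossed links. -/
theorem exists_card_filter_le [Finite E] (h : IsExecution G P r b δ R) (hr : 0 ≤ r) (hr1 : r ≤ 1)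
    (H : ℕ → ℕ → R.Packet → Prop)
    (h₀ : ∀ t, ∀ p ∈ R.inSystem t, ¬ H 0 (R.crossed t p) p)
    (hrank : ∀ j t, ∀ p ∈ R.inSystem t, ∀ q ∈ R.inSystem t, H j (R.crossed t p) p →
      P.rank (R.view t p) ≤ P.rank (R.view t q) → H j (R.crossed t q) q)
    (hprev : ∀ j t, ∀ p ∈ R.inSystem t, ∀ c < R.crossed t p, H (j + 1) (R.crossed t p) p → H j c p)
    (j : ℕ) :
    ∃ K : ℕ, ∀ t, ((R.inSystem t).filter fun p => H j (R.crossed t p) p).card ≤ K := by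
  have := Fintype.ofFinite E
  induction j with
  | zero =>
    refine ⟨0, fun t => ?_⟩
    rw [Finset.filter_false_of_mem fun p hp => h₀ t p hp]
    simp
  | succ j ih =>
    obtain ⟨K, hK⟩ := ih
    -- The `1` accounts for round `t`, whose injections count but whose transmissions do not.
    refine ⟨Fintype.card E * (K + (b + 2 * δ) + 1), fun t => ?_⟩
    refine (card_filter_inSystem_le_sum t _).trans ?_
    refine (Finset.sum_le_card_nsmul _ _ (K + (b + 2 * δ) + 1) fun e _ => ?_).trans_eq (by simp)
    set S := (R.inSystem t).filter fun p => p ∈ R.queue t e ∧ H (j + 1) (R.crossed t p) p with hS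
    have hbusy : ∀ u, (∃ p ∈ R.queue u e, H (j + 1) (R.crossed u p) p) → ∀ q,
        R.attempt u e = some q → H (j + 1) (R.crossed u q) q := by
      rintro u ⟨p, hp, hHp⟩ q hq
      exact hrank _ u p (Run.mem_inSystem_of_mem_queue hp) q
        (Run.mem_inSystem_of_mem_queue (h.attempt_mem u e q hq)) hHp (h.attempt_rank u e q hq p hp)
    -- Round `a` follows the last round `x < t` without class `j + 1` packets at `e`. Older packets
    -- of that class were elsewhere in round `x`, have crossed a link since, and so belonged to
    -- class `j` then: they form `F`. If there is no such `x`, take `a = 0`.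
    obtain ⟨a, F, hF, hat, hab, haF⟩ : ∃ (a : ℕ) (F : Finset R.Packet), F.card ≤ K ∧ a ≤ t ∧
        (∀ u, a ≤ u → u < t → ∃ p ∈ R.queue u e, H (j + 1) (R.crossed u p) p) ∧
        ∀ u, a ≤ u → u ≤ t → ∀ p ∈ R.queue u e, H (j + 1) (R.crossed u p) p → a ≤ p.1 ∨ p ∈ F := by
      by_cases hex : ∀ u < t, ∃ p ∈ R.queue u e, H (j + 1) (R.crossed u p) p
      · exact ⟨0, ∅, by simp, by omega, fun u _ hu => hex u hu, fun _ _ _ _ _ _ =>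
          Or.inl (Nat.zero_le _)⟩
      · push Not at hex
        obtain ⟨s, hs⟩ := hex
        let B : ℕ → Prop := fun s => s < t ∧ ∀ p ∈ R.queue s e, ¬ H (j + 1) (R.crossed s p) p
        have hB : B (Nat.findGreatest B t) := Nat.findGreatest_spec hs.1.le hs
        set x := Nat.findGreatest B t with hx
        refine ⟨x + 1, (R.inSystem x).filter fun p => H j (R.crossed x p) p, hK x, hB.1, ?_, ?_⟩
        · intro u hu hut
          by_contra hcon
          push Not at hcon
          have := Nat.le_findGreatest hut.le (show B u from ⟨hut, hcon⟩)
          omega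
        · intro u hxu hut p hp hHp
          rw [or_iff_not_imp_left]
          intro hpx
          have h1 := R.crossed_mono p (show x ≤ u by omega)
          simp only at h1
          have h2 := Run.mem_inSystem.1 (Run.mem_inSystem_of_mem_queue hp)
          refine Finset.mem_filter.2 ⟨Run.mem_inSystem.2 ⟨by omega, by omega⟩, ?_⟩
          refine hprev j u p (Run.mem_inSystem_of_mem_queue hp) _ (lt_of_le_of_ne h1 ?_) hHp
          intro heq
          refine hB.2 p ⟨by omega, ?_⟩ ?_
          · rw [heq]
            exact hp.2
          · rw [heq]
            exact hHp
    have h1 := h.card_add_openRounds_le (e := e) (a := a) (c := a) (t := t)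
      (fun u h1 h2 => (hab u h1 h2).imp fun p hp => hp.1) S F
      (fun p hp => by
        obtain ⟨-, h1, h2⟩ := Finset.mem_filter.1 hp
        exact ⟨h1, haF t hat le_rfl p h1 h2⟩)
      (fun u p h1 h2 hp => haF u h1 h2.le p (h.attempt_mem u e p hp) (hbusy u (hab u h1 h2) p hp))
    have h2 := h.sum_injections_le_nat hr hr1 e hat
    have h3 := R.openRounds_succ_le e a t
    omega

/-- A policy is stable if some class of preferred packets contains all packets in the system. -/
theorem exists_card_inSystem_le [Finite E] (h : IsExecution G P r b δ R) (hr : 0 ≤ r)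
    (hr1 : r ≤ 1) (H : ℕ → ℕ → R.Packet → Prop) (n : ℕ)
    (h₀ : ∀ t, ∀ p ∈ R.inSystem t, ¬ H 0 (R.crossed t p) p)
    (hn : ∀ t, ∀ p ∈ R.inSystem t, H n (R.crossed t p) p)
    (hrank : ∀ j t, ∀ p ∈ R.inSystem t, ∀ q ∈ R.inSystem t, H j (R.crossed t p) p →
      P.rank (R.view t p) ≤ P.rank (R.view t q) → H j (R.crossed t q) q)
    (hprev : ∀ j t, ∀ p ∈ R.inSystem t, ∀ c < R.crossed t p,
      H (j + 1) (R.crossed t p) p → H j c p) :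
    ∃ B : ℕ, ∀ t, (R.inSystem t).card ≤ B := by
  classical
  obtain ⟨B, hB⟩ := h.exists_card_filter_le hr hr1 H h₀ hrank hprev n
  exact ⟨B, fun t => (Finset.card_le_card fun p hp => Finset.mem_filter.2 ⟨hp, hn t p hp⟩).trans
    (hB t)⟩

theorem exists_card_inSystem_le_NFS [Finite E] (h : IsExecution G .NFS r b δ R) (hr : 0 ≤ r)
    (hr1 : r ≤ 1) : ∃ B : ℕ, ∀ t, (R.inSystem t).card ≤ B := by
  have := Fintype.ofFinite E
  refine h.exists_card_inSystem_le hr hr1 (fun j c _ => c < j) (Fintype.card E) (by simp)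
    (fun t p hp => (Run.mem_inSystem.1 hp).2.trans_le (h.length_route_le p))
    (fun j t p _ q _ h1 h2 => ?_) (fun j t p _ c hc h1 => by omega)
  simp only [SchedulingPolicy.NFS, Run.view] at h2
  omega

theorem exists_card_inSystem_le_FTG [Finite E] (h : IsExecution G .FTG r b δ R) (hr : 0 ≤ r)
    (hr1 : r ≤ 1) : ∃ B : ℕ, ∀ t, (R.inSystem t).card ≤ B := by
  have := Fintype.ofFinite E
  refine h.exists_card_inSystem_le hr hr1
    -- Class `j` has more than `card E - j` links left, written without subtracting `j`.
    (fun j c p => Fintype.card E < (R.route p).length - c + j) (Fintype.card E)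
    (fun t p _ => ?_) (fun t p hp => ?_) (fun j t p _ q _ h1 h2 => ?_)
    (fun j t p hp c hc h1 => ?_)
  · have := h.length_route_le p
    omega
  · have := (Run.mem_inSystem.1 hp).2
    omega
  · simp only [SchedulingPolicy.FTG, Run.view] at h2
    omega
  · have := (Run.mem_inSystem.1 hp).2
    omega

end IsExecution

/-! ### Two inequalities for natural numbers -/

theorem Finset.card_sq_le_two_mul_sum_card_filter_le {α : Type*} (S : Finset α) (f : α → ℕ) :
    S.card ^ 2 ≤ 2 * ∑ p ∈ S, (S.filter fun q => f p ≤ f q).card := by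
  have h1 : ∑ p ∈ S, (S.filter fun q => f p ≤ f q).card =
      ∑ p ∈ S, (S.filter fun q => f q ≤ f p).card :=
    Finset.sum_card_bipartiteAbove_eq_sum_card_bipartiteBelow fun p q => f p ≤ f q
  have h2 : ∀ p ∈ S, S.card ≤
      (S.filter fun q => f p ≤ f q).card + (S.filter fun q => f q ≤ f p).card := by
    classical
    intro p _
    refine le_trans (Finset.card_le_card fun q hq => ?_) (Finset.card_union_le _ _)
    simpa [hq] using le_total (f p) (f q)
  have h3 := Finset.sum_le_sum h2
  rw [Finset.sum_add_distrib, ← h1, Finset.sum_const, smul_eq_mul] at h3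
  rw [sq]
  omega

/-- A sequence with `x (i + 1) ^ 2 ≤ C * x i * X` can reach `X` in `n` steps only if `X` is small. -/
theorem le_pow_of_sq_le_mul {C X : ℕ} (hC : 1 ≤ C) (x : ℕ → ℕ) (h₀ : x 0 = 1)
    (hx : ∀ i, x (i + 1) ^ 2 ≤ C * x i * X) {n : ℕ} (hX : X ≤ x n) : X ≤ C ^ 2 ^ n := by
  -- In real terms, `x i / X ≤ C * X ^ (-1 / 2 ^ i)`.
  have key : ∀ i, x i ^ 2 ^ i * X ≤ C ^ 2 ^ i * X ^ 2 ^ i := by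
    intro i
    induction i with
    | zero => simpa [h₀] using Nat.le_mul_of_pos_left X hC
    | succ i ih =>
      calc x (i + 1) ^ 2 ^ (i + 1) * X = (x (i + 1) ^ 2) ^ 2 ^ i * X := by
            rw [← pow_mul, pow_succ' 2 i]
        _ ≤ (C * x i * X) ^ 2 ^ i * X := by
            gcongr
            exact hx i
        _ = C ^ 2 ^ i * X ^ 2 ^ i * (x i ^ 2 ^ i * X) := by ring
        _ ≤ C ^ 2 ^ i * X ^ 2 ^ i * (C ^ 2 ^ i * X ^ 2 ^ i) := by gcongr
        _ = C ^ 2 ^ (i + 1) * X ^ 2 ^ (i + 1) := by ring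
  rcases Nat.eq_zero_or_pos X with h0 | h0
  · omega
  · have h1 : X ^ 2 ^ n * X ≤ X ^ 2 ^ n * C ^ 2 ^ n := by
      calc X ^ 2 ^ n * X ≤ x n ^ 2 ^ n * X := by gcongr
        _ ≤ _ := key n
        _ = _ := mul_comm _ _
    exact Nat.le_of_mul_le_mul_left h1 (by positivity)

/-! ### Shortest-In-System -/

namespace IsExecution

variable {V E : Type*} {G : Network V E} {P : SchedulingPolicy} {r : ℝ} {b δ : ℕ} {R : Run E}

/-- A link whose queue is nonempty in `[a, t)` is open in few of these rounds if there are few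
packets in the system in round `a`. -/
theorem openRounds_le_of_nonempty (h : IsExecution G P r b δ R) (hr : 0 ≤ r) (hr1 : r ≤ 1)
    {m : ℕ} (hm : 1 ≤ m * (1 - r)) {e : E} {a t : ℕ} (hat : a ≤ t)
    (hq : ∀ u, a ≤ u → u < t → (R.queue u e).Nonempty) :
    R.openRounds e a t ≤ m * ((R.inSystem a).card + (b + 2 * δ) + 1) := by
  have h1 := h.card_add_openRounds_le (e := e) (a := a) (c := a) (t := t) hq ∅ (R.inSystem a)
    (by simp) fun u p hau _ hp => by
      rw [or_iff_not_imp_left]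
      intro hpa
      have h2 := Run.mem_inSystem.1 (Run.mem_inSystem_of_mem_queue (h.attempt_mem u e p hp))
      exact Run.mem_inSystem.2 ⟨by omega, (R.crossed_mono p hau).trans_lt h2.2⟩
  have h2 := h.sum_injections_le hr hr1 e hat
  have h3 : (R.openRounds e a (t + 1) : ℝ) ≤ R.openRounds e a t + 1 := by
    exact_mod_cast R.openRounds_succ_le e a t
  have h4 : (R.openRounds e a t : ℝ) ≤ (R.inSystem a).card +
      (∑ x ∈ Finset.Icc a t, R.injections e x : ℕ) := by
    rw [Finset.card_empty, zero_add] at h1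
    exact_mod_cast h1
  have h5 := mul_le_mul_of_nonneg_left h3 hr
  have h6 : (1 - r) * (R.openRounds e a t : ℝ) ≤ (R.inSystem a).card + (b + 2 * δ : ℕ) + 1 := by
    linarith
  have h7 : (R.openRounds e a t : ℝ) ≤ m * ((R.inSystem a).card + (b + 2 * δ : ℕ) + 1) := by
    -- The argument uses `r < 1` only here, through `m ≥ 1 / (1 - r)`.
    calc (R.openRounds e a t : ℝ) ≤ (m * (1 - r)) * R.openRounds e a t :=
          le_mul_of_one_le_left (by positivity) hm
      _ = m * ((1 - r) * R.openRounds e a t) := by ring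
      _ ≤ _ := by gcongr
  exact_mod_cast h7

/-- Under Shortest-In-System, the number of packets of a queue that are at least as new as a packet
`p` is bounded by the number of open rounds of the link from the injection of `p` to its arrival. -/
theorem card_newer_le_openRounds (h : IsExecution G .SIS r b δ R) (hr : 0 ≤ r) (hr1 : r ≤ 1)
    {e : E} {a t : ℕ} {p : R.Packet} (ha : p ∈ R.queue a e) (ht : p ∈ R.queue t e)
    (S : Finset R.Packet) (hS : ∀ q ∈ S, q ∈ R.queue t e ∧ p.1 ≤ q.1) :
    S.card ≤ R.openRounds e p.1 a + (b + 2 * δ) + 1 := by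
  -- While `p` waits, only packets at least as new cross `e`. The open rounds of `[a, t)` then
  -- cancel against the injections allowed there.
  have h1 := h.card_add_openRounds_le (e := e) (a := a) (c := p.1) (t := t)
    (fun u hau hut => ⟨p, h.mem_queue_of_mem_Icc ha ht hau hut.le⟩) S ∅
    (fun q hq => ⟨(hS q hq).1, Or.inl (hS q hq).2⟩)
    (fun u q hau hut hq => Or.inl (by
      have := h.attempt_rank u e q hq p (h.mem_queue_of_mem_Icc ha ht hau hut.le)
      simpa [SchedulingPolicy.SIS, Run.view] using this))
  have h2 := h.sum_injections_le_nat hr hr1 e ht.1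
  have h3 := R.openRounds_succ_le e p.1 t
  have h4 := R.openRounds_le_add e p.1 a t
  rw [Finset.card_empty, zero_add] at h1
  omega

theorem exists_first_mem_queue {t : ℕ} {e : E} {p : R.Packet} (hp : p ∈ R.queue t e) :
    ∃ a ≤ t, p ∈ R.queue a e ∧ ∀ u < a, p ∉ R.queue u e := by
  classical
  have hex : ∃ a, p ∈ R.queue a e := ⟨t, hp⟩
  exact ⟨Nat.find hex, Nat.find_le hp, Nat.find_spec hex, fun u hu => Nat.find_min hex hu⟩

open Classical in
-- Counts pairs of a packet of `S` and an open round of `e` between its injection and its arrival at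
-- `e`, within a final window of limited length.
theorem card_queue_sq_le (h : IsExecution G .SIS r b δ R) (hr : 0 ≤ r) (hr1 : r ≤ 1)
    {m : ℕ} (hm : 1 ≤ m * (1 - r)) (e : E) {t i K Z : ℕ}
    (hK : ∀ u ≤ t, ((R.inSystem u).filter fun p => R.crossed u p < i).card ≤ K)
    (hZ : ∀ u ≤ t, (R.inSystem u).card ≤ Z) {S : Finset R.Packet}
    (hS : ∀ p ∈ S, p ∈ R.queue t e ∧ R.crossed t p < i + 1) :
    S.card ^ 2 ≤ 2 * ((m * (Z + (b + 2 * δ) + 1) + S.card) * K + S.card * (b + 2 * δ + 1)) := by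
  have hex : ∀ p ∈ S, ∃ a ≤ t, p ∈ R.queue a e ∧ ∀ u < a, p ∉ R.queue u e :=
    fun p hp => exists_first_mem_queue (hS p hp).1
  choose! a hat ha hmin using hex
  set L := m * (Z + (b + 2 * δ) + 1) with hL
  -- At most `L` open rounds follow the arrival of a packet of `S`. So a packet injected before the
  -- window travels during at least `S.card` of the window's open rounds, enough for the trivial
  -- bound on its newer companions.
  have hx0 : ∃ x, R.openRounds e x t ≤ L + S.card := ⟨t, by simp [Run.openRounds_self]⟩
  set x := Nat.find hx0 with hx
  have hxle : R.openRounds e x t ≤ L + S.card := Nat.find_spec hx0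
  have hxge : x = 0 ∨ L + S.card ≤ R.openRounds e x t := by
    rw [or_iff_not_imp_left]
    intro hne
    have h1 : ¬ R.openRounds e (x - 1) t ≤ L + S.card := Nat.find_min hx0 (by omega)
    have h2 := R.openRounds_le_add e (x - 1) x t
    have h3 := R.openRounds_succ_le e (x - 1) (x - 1)
    rw [Run.openRounds_self, Nat.sub_add_cancel (by omega)] at h3
    omega
  set U := (Finset.Ico x t).filter fun u => ¬ R.stalled u e with hU
  have hlower : ∀ p ∈ S, (S.filter fun q => p.1 ≤ q.1).card ≤
      (U.filter fun u => p.1 ≤ u ∧ u < a p).card + (b + 2 * δ + 1) := by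
    intro p hp
    have h1 : R.openRounds e (max x p.1) (a p) ≤
        (U.filter fun u => p.1 ≤ u ∧ u < a p).card := by
      refine Finset.card_le_card fun u hu => ?_
      have := hat p hp
      simp only [hU, Finset.mem_filter, Finset.mem_Ico] at hu ⊢
      exact ⟨⟨by omega, hu.2⟩, by omega⟩
    rcases le_or_gt x p.1 with hxp | hxp
    · rw [max_eq_right hxp] at h1
      have := h.card_newer_le_openRounds hr hr1 (ha p hp) (hS p hp).1
        (S.filter fun q => p.1 ≤ q.1) fun q hq => by
          rw [Finset.mem_filter] at hq
          exact ⟨(hS q hq.1).1, hq.2⟩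
      omega
    · rw [max_eq_left hxp.le] at h1
      have h2 := h.openRounds_le_of_nonempty hr hr1 hm (e := e) (hat p hp) fun u h1 h2 =>
        ⟨p, h.mem_queue_of_mem_Icc (ha p hp) (hS p hp).1 h1 h2.le⟩
      have h3 : m * ((R.inSystem (a p)).card + (b + 2 * δ) + 1) ≤ L := by
        rw [hL]
        gcongr
        exact hZ _ (hat p hp)
      have h4 := R.openRounds_le_add e x (a p) t
      have h5 := Finset.card_filter_le S fun q => p.1 ≤ q.1
      omega
  have hupper : ∑ p ∈ S, (U.filter fun u => p.1 ≤ u ∧ u < a p).card ≤ (L + S.card) * K := by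
    have h1 : ∑ p ∈ S, (U.filter fun u => p.1 ≤ u ∧ u < a p).card =
        ∑ u ∈ U, (S.filter fun p => p.1 ≤ u ∧ u < a p).card :=
      Finset.sum_card_bipartiteAbove_eq_sum_card_bipartiteBelow
        fun (p : R.Packet) u => p.1 ≤ u ∧ u < a p
    rw [h1]
    refine (Finset.sum_le_card_nsmul _ _ K fun u hu => ?_).trans ?_
    · simp only [hU, Finset.mem_filter, Finset.mem_Ico] at hu
      refine le_trans (Finset.card_le_card fun p hp => ?_) (hK u hu.1.2.le)
      rw [Finset.mem_filter] at hp
      obtain ⟨hpS, hpu, hua⟩ := hp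
      have h2 := R.crossed_mono p hu.1.2.le
      simp only at h2
      have h3 := hS p hpS
      have h4 := Run.mem_inSystem.1 (Run.mem_inSystem_of_mem_queue h3.1)
      -- Before reaching `e`, the packet has crossed strictly fewer links, hence fewer than `i`.
      have h5 : R.crossed u p ≠ R.crossed t p := fun heq =>
        hmin p hpS u hua ⟨hpu, heq ▸ h3.1.2⟩
      exact Finset.mem_filter.2 ⟨Run.mem_inSystem.2 ⟨hpu, by omega⟩, by omega⟩
    · rw [smul_eq_mul]
      exact Nat.mul_le_mul_right K hxle
  refine (S.card_sq_le_two_mul_sum_card_filter_le fun p => p.1).trans ?_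
  gcongr
  refine (Finset.sum_le_sum hlower).trans ?_
  rw [Finset.sum_add_distrib, Finset.sum_const, smul_eq_mul]
  exact Nat.add_le_add_right hupper _

open Classical in
-- Cauchy–Schwarz over the links; adding `1` to each count absorbs the lower-order terms into one
-- product.
theorem card_filter_crossed_sq_le [Fintype E] (h : IsExecution G .SIS r b δ R) (hr : 0 ≤ r)
    (hr1 : r ≤ 1) {m : ℕ} (hm : 1 ≤ m * (1 - r)) {t i K Z : ℕ}
    (hK : ∀ u ≤ t, ((R.inSystem u).filter fun p => R.crossed u p < i).card ≤ K)
    (hZ : ∀ u ≤ t, (R.inSystem u).card ≤ Z) :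
    (((R.inSystem t).filter fun p => R.crossed t p < i + 1).card + 1) ^ 2 ≤
      (4 * Fintype.card E ^ 2 * ((m + 1) * (b + 2 * δ + 1)) + 2) * (K + 1) * (Z + 1) := by
  set β := b + 2 * δ + 1 with hβ
  set n : E → ℕ := fun e =>
    ((R.inSystem t).filter fun p => p ∈ R.queue t e ∧ R.crossed t p < i + 1).card with hn
  have h1 : ∀ e ∈ Finset.univ, n e ^ 2 ≤ 2 * ((m + 1) * β) * (K + 1) * (Z + 1) := by
    intro e _
    have h1 := h.card_queue_sq_le hr hr1 hm e hK hZ (S := (R.inSystem t).filter fun p =>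
      p ∈ R.queue t e ∧ R.crossed t p < i + 1) fun p hp => (Finset.mem_filter.1 hp).2
    have h2 : n e ≤ Z := (Finset.card_filter_le _ _).trans (hZ t le_rfl)
    calc n e ^ 2 ≤ 2 * ((m * (Z + (b + 2 * δ) + 1) + n e) * K + n e * (b + 2 * δ + 1)) := h1
      _ ≤ 2 * ((m * (Z * β + β) + Z * β) * K + Z * β) := by
          have h3 : Z ≤ Z * β := Nat.le_mul_of_pos_right _ (by omega)
          have h4 : n e * (b + 2 * δ + 1) ≤ Z * β := Nat.mul_le_mul_right _ h2
          have h5 : Z + (b + 2 * δ) + 1 ≤ Z * β + β := by omega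
          have h6 : n e ≤ Z * β := h2.trans h3
          gcongr
      _ ≤ 2 * ((m + 1) * β) * (K + 1) * (Z + 1) := by
          nlinarith [Nat.zero_le (β * K), Nat.zero_le (m * β), Nat.zero_le (m * β * Z),
            Nat.zero_le β]
  have h2 : (∑ e, n e) ^ 2 ≤
      Fintype.card E ^ 2 * (2 * ((m + 1) * β) * (K + 1) * (Z + 1)) := by
    calc (∑ e, n e) ^ 2 ≤ Fintype.card E * ∑ e, n e ^ 2 := sq_sum_le_card_mul_sum_sq
      _ ≤ Fintype.card E * (Fintype.card E * (2 * ((m + 1) * β) * (K + 1) * (Z + 1))) := by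
          gcongr
          simpa using Finset.sum_le_card_nsmul _ _ _ h1
      _ = _ := by ring
  have h3 : ((R.inSystem t).filter fun p => R.crossed t p < i + 1).card ≤ ∑ e, n e := by
    refine le_of_eq_of_le ?_ ((card_filter_inSystem_le_sum (R := R) t fun p =>
      R.crossed t p < i + 1).trans_eq (Finset.sum_congr rfl fun e _ => ?_))
    all_goals congr
  have h4 : 1 ≤ (K + 1) * (Z + 1) := Nat.mul_pos (by omega) (by omega)
  calc _ ≤ (∑ e, n e + 1) ^ 2 := by gcongr
    _ ≤ 2 * (∑ e, n e) ^ 2 + 2 * 1 := by nlinarith [two_mul_le_add_sq (∑ e, n e) 1]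
    _ ≤ 2 * (Fintype.card E ^ 2 * (2 * ((m + 1) * β) * (K + 1) * (Z + 1))) +
        2 * ((K + 1) * (Z + 1)) := by gcongr
    _ = _ := by ring

theorem exists_card_inSystem_le_SIS [Finite E] (h : IsExecution G .SIS r b δ R) (hr : 0 ≤ r)
    (hr1 : r < 1) : ∃ B : ℕ, ∀ t, (R.inSystem t).card ≤ B := by
  classical
  have := Fintype.ofFinite E
  obtain ⟨m, hm⟩ := exists_nat_ge (1 / (1 - r))
  rw [div_le_iff₀ (by linarith)] at hm
  set C := 4 * Fintype.card E ^ 2 * ((m + 1) * (b + 2 * δ + 1)) + 2 with hC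
  refine ⟨C ^ 2 ^ Fintype.card E, fun t => ?_⟩
  have htotal : ∀ u, ((R.inSystem u).filter fun p => R.crossed u p < Fintype.card E) =
      R.inSystem u := fun u => Finset.filter_true_of_mem fun p hp =>
    (Run.mem_inSystem.1 hp).2.trans_le (h.length_route_le p)
  -- Truncating at `t` makes the maximum finite; the resulting bound does not depend on `t`.
  let k : ℕ → ℕ := fun i => (Finset.range (t + 1)).sup fun u =>
    ((R.inSystem u).filter fun p => R.crossed u p < i).card
  have hk : ∀ i, ∀ u ≤ t, ((R.inSystem u).filter fun p => R.crossed u p < i).card ≤ k i :=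
    fun i u hu => Finset.le_sup (f := fun u =>
      ((R.inSystem u).filter fun p => R.crossed u p < i).card) (by simp; omega)
  have hZ : ∀ u ≤ t, (R.inSystem u).card ≤ k (Fintype.card E) := fun u hu => by
    have := hk (Fintype.card E) u hu
    rwa [htotal] at this
  have hmain : k (Fintype.card E) + 1 ≤ C ^ 2 ^ Fintype.card E := by
    refine le_pow_of_sq_le_mul (by omega) (fun i => k i + 1) (by simp [k]) (fun i => ?_) le_rfl
    obtain ⟨u, hu, hku⟩ := Finset.exists_mem_eq_sup (Finset.range (t + 1)) (by simp) fun u =>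
      ((R.inSystem u).filter fun p => R.crossed u p < i + 1).card
    rw [Finset.mem_range] at hu
    rw [show k (i + 1) = _ from hku]
    exact h.card_filter_crossed_sq_le hr hr1.le hm (fun v hv => hk i v (by omega))
      fun v hv => hZ v (by omega)
  exact (hZ t le_rfl).trans (by omega)

end IsExecution

theorem mainTheorem2 (δ : ℕ) (hδ : 1 ≤ δ) :
    IsUniversallyStable.{u, v} δ SchedulingPolicy.FTG ∧
    IsUniversallyStable.{u, v} δ SchedulingPolicy.NFS ∧
    IsUniversallyStable.{u, v} δ SchedulingPolicy.SIS :=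
  ⟨fun _ _ _ _ _ _ _ hr hr1 _ _ h => h.exists_card_inSystem_le_FTG hr hr1.le,
    fun _ _ _ _ _ _ _ hr hr1 _ _ h => h.exists_card_inSystem_le_NFS hr hr1.le,
    fun _ _ _ _ _ _ _ hr hr1 _ _ h => h.exists_card_inSystem_le_SIS hr hr1⟩
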